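/- Let $K$ be a field. A Hom-Leibniz algebra $(\mathfrak g,\alpha_{\mathfrak g})$ over $K$ is a $K$-vector space $\mathfrak g$ with a bilinear product $[\,,]$ and a linear map $\alpha_{\mathfrak g}:\mathfrak g\to\mathfrak g$ such that, for all $x,y,z\in\mathfrak g$, $\alpha_{\mathfrak g}([x,y])=[\alpha_{\mathfrak g}(x),\alpha_{\mathfrak g}(y)]$ and $$[\alpha_{\mathfrak g}(x),[y,z]]=[[x,y],\alpha_{\mathfrak g}(z)]-[[x,z],\alpha_{\mathfrak g}(y)].$$ A Hom-vector space is a vector space with a linear self-map; homomorphisms (of Hom-vector spaces, of Hom-Leibniz algebras) are the linear maps (preserving the products, in the second case) that commute with the given self-maps. For $n\ge 1$ let $d_n:\mathfrak g^{\otimes n}\to\mathfrak g^{\otimes (n-1)}$ (with $\mathfrak g^{\otimes 0}=K$) be the linear map $$d_n(x_1\otimes\cdots\otimes x_n)=\sum_{1\le i<j\le n}(-1)^{j+1}\,\alpha_{\mathfrak g}(x_1)\otimes\cdots\otimes\alpha_{\mathfrak g}(x_{i-1})\otimes[x_i,x_j]\otimes\alpha_{\mathfrak g}(x_{i+1})\otimes\cdots\otimes\widehat{\alpha_{\mathfrak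 g}(x_j)}\otimes\cdots\otimes\alpha_{\mathfrak g}(x_n),$$ where the hat marks an omitted factor. For $n\ge1$ the $n$-th homology of $(\mathfrak g,\alpha_{\mathfrak g})$ (with trivial coefficients) is $HL_n^\alpha(\mathfrak g)=\ker(d_n)/\operatorname{Im}(d_{n+1})$, a Hom-vector space with the self-map induced by $\alpha_{\mathfrak g}^{\otimes n}$. A Hom-Leibniz algebra $(\mathfrak f,\alpha_{\mathfrak f})$ is free if there are a Hom-vector space $(V,\alpha_V)$ and a homomorphism of Hom-vector spaces $\iota:(V,\alpha_V)\to(\mathfrak f,\alpha_{\mathfrak f})$ such that every homomorphism of Hom-vector spaces $f$ from $(V,\alpha_V)$ to a Hom-Leibniz algebra $(\mathfrak a,\alpha_{\mathfrak a})$ is $\varphi\circ\iota$ for a unique homomorphism of Hom-Leibniz algebras $\varphi:(\mathfrak f,\alpha_{\mathfrak f})\to(\mathfrak a,\alpha_{\mathfrak a})$. A free presentation $\mathfrak r\rightarrowtail\mathfrak f\twoheadrightarrow\mathfrak g$ of $(\mathfrak g,\alpha_{\mathfrak g})$ is a surjective homomorphism $\pi$ of Hom-Leibniz algebras from a free Hom-Leibniz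 algebra $(\mathfrak f,\alpha_{\mathfrak f})$ to $(\mathfrak g,\alpha_{\mathfrak g})$, with $\mathfrak r=\ker\pi$. For ideals $\mathfrak h,\mathfrak k$ of $\mathfrak f$, the commutator $[\mathfrak h,\mathfrak k]$ is the Hom-Leibniz subalgebra (the smallest $\alpha_{\mathfrak f}$-invariant subspace closed under the product) generated by all $[h,k]$ and $[k,h]$ with $h\in\mathfrak h$, $k\in\mathfrak k$. **Corollary 4.5 (Hopf's formula for Hom-Leibniz algebras).** For every Hom-Leibniz algebra $(\mathfrak g,\alpha_{\mathfrak g})$ and every free presentation $\mathfrak r\rightarrowtail\mathfrak f\twoheadrightarrow\mathfrak g$ of it, there is an isomorphism of Hom-vector spaces $$HL_2^\alpha(\mathfrak g)\;\cong\;\mathcal M(\mathfrak g,\alpha_{\mathfrak g})=\frac{\mathfrak r\cap[\mathfrak f,\mathfrak f]}{[\mathfrak f,\mathfrak r]},$$ where the Schur multiplier $\mathcal M(\mathfrak g,\alpha_{\mathfrak g})$ carries the self-map induced by $\alpha_{\mathfrak f}$. -/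

import Mathlib

open scoped TensorProduct

universe u v w

/-- A (multiplicative) Hom-Leibniz algebra structure on a vector space `g`: a bilinear product,
and a linear self-map `α` that preserves the product, subject to the Hom-Leibniz identity. -/
structure HomLeibniz (K : Type u) [Field K] (g : Type v) [AddCommGroup g] [Module K g] where
  bracket : g →ₗ[K] g →ₗ[K] g
  α : g →ₗ[K] g
  hom_leibniz : ∀ x y z : g, bracket (α x) (bracket y z) =
    bracket (bracket x y) (α z) - bracket (bracket x z) (α y)
  map_bracket : ∀ x y : g, α (bracket x y) = bracket (α x) (α y)

namespace HomLeibniz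

section Basic

variable {K : Type u} [Field K]
variable {g : Type*} [AddCommGroup g] [Module K g]
variable {g' : Type*} [AddCommGroup g'] [Module K g']

/-- Homomorphisms of Hom-Leibniz algebras. -/
structure IsHom (L : HomLeibniz K g) (L' : HomLeibniz K g') (f : g →ₗ[K] g') : Prop where
  map_bracket : ∀ x y : g, f (L.bracket x y) = L'.bracket (f x) (f y)
  map_α : ∀ x : g, f (L.α x) = L'.α (f x)

/-- Hom-Leibniz subalgebras: subspaces closed under the product and invariant under `α`. -/
structure IsSubalgebra (L : HomLeibniz K g) (S : Submodule K g) : Prop where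
  bracket_mem : ∀ x ∈ S, ∀ y ∈ S, L.bracket x y ∈ S
  α_mem : ∀ x ∈ S, L.α x ∈ S

/-- The (Higgins) commutator `[H, H']`: the Hom-Leibniz subalgebra generated by all the products
`[h, k]` and `[k, h]` with `h ∈ H` and `k ∈ H'`. -/
def commutator (L : HomLeibniz K g) (H H' : Submodule K g) : Submodule K g :=
  sInf {S : Submodule K g | L.IsSubalgebra S ∧
    ∀ h ∈ H, ∀ k ∈ H', L.bracket h k ∈ S ∧ L.bracket k h ∈ S}

theorem commutator_α_mem (L : HomLeibniz K g) (H H' : Submodule K g) (x : g)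
    (hx : x ∈ L.commutator H H') : L.α x ∈ L.commutator H H' := by
  rw [commutator, Submodule.mem_sInf] at hx ⊢
  exact fun S hS => hS.1.α_mem x (hx S hS)

end Basic

/-! ### Homology with trivial coefficients -/

section Homology

variable {K : Type u} [Field K] {g : Type v} [AddCommGroup g] [Module K g]

/-- The tuple `(α x₀, …, [x i, x j], …, α xₙ)`: the entry `i` is replaced by `[x i, x j]`, the
entry `j` is omitted, and `α` is applied to all the other entries. -/
def slot (L : HomLeibniz K g) {n : ℕ} (i j : Fin (n + 1)) (x : Fin (n + 1) → g) : Fin n → g :=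
  fun k => if j.succAbove k = i then L.bracket (x i) (x j) else L.α (x (j.succAbove k))

theorem slot_update (L : HomLeibniz K g) {n : ℕ} {i j : Fin (n + 1)} (hij : i ≠ j)
    (m : Fin (n + 1)) (x : Fin (n + 1) → g) :
    ∃ (k : Fin n) (f : g →ₗ[K] g),
      ∀ a : g, L.slot i j (Function.update x m a) = Function.update (L.slot i j x) k (f a) := by
  obtain ⟨ki, hki⟩ := Fin.exists_succAbove_eq hij
  by_cases hmi : m = i
  · subst hmi
    refine ⟨ki, L.bracket.flip (x j), fun a => ?_⟩
    funext k
    by_cases hk : k = ki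
    · subst hk
      simp [slot, hki, hij.symm]
    · have : j.succAbove k ≠ m := fun h => hk (Fin.succAbove_right_injective (h.trans hki.symm))
      simp [slot, hk, this]
  · by_cases hmj : m = j
    · subst hmj
      refine ⟨ki, L.bracket (x i), fun a => ?_⟩
      funext k
      by_cases hk : k = ki
      · subst hk
        simp [slot, hki, hij]
      · have : m.succAbove k ≠ i := fun h => hk (Fin.succAbove_right_injective (h.trans hki.symm))
        simp [slot, hk, this, Fin.succAbove_ne]
    · obtain ⟨km, hkm⟩ := Fin.exists_succAbove_eq hmj
      refine ⟨km, L.α, fun a => ?_⟩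
      funext k
      by_cases hk : k = km
      · subst hk
        simp [slot, hkm, hmi]
      · have : j.succAbove k ≠ m := fun h => hk (Fin.succAbove_right_injective (h.trans hkm.symm))
        simp [slot, hk, this, Ne.symm hmi, Ne.symm hmj]

/-- The multilinear map `x ↦ α x₀ ⊗ ⋯ ⊗ [x i, x j] ⊗ ⋯ ⊗ α xₙ` (with the factor `j` omitted). -/
noncomputable def term (L : HomLeibniz K g) {n : ℕ} {i j : Fin (n + 1)} (hij : i ≠ j) :
    MultilinearMap K (fun _ : Fin (n + 1) => g) (⨂[K]^n g) :=
  MultilinearMap.mk' (fun x => PiTensorProduct.tprod K (L.slot i j x))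
    (by
      intro x m a b
      obtain ⟨k, f, hf⟩ := L.slot_update hij m x
      simp only [hf, map_add, MultilinearMap.map_update_add])
    (by
      intro x m c a
      obtain ⟨k, f, hf⟩ := L.slot_update hij m x
      simp only [hf, map_smul, MultilinearMap.map_update_smul])

/-- The boundary map `g^{⊗(n+1)} → g^{⊗n}` of the complex of `(g, α)` with coefficients in the
trivial Hom-co-representation `(K, id)`. The factors are numbered from `0`, so that the usual sign
`(-1)^(j+1)` of the summand `(i, j)` becomes `(-1)^j`; the summands in which `g` acts on the
coefficients vanish. -/
noncomputable def d (L : HomLeibniz K g) (n : ℕ) : (⨂[K]^(n + 1) g) →ₗ[K] (⨂[K]^n g) :=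
  ∑ j : Fin (n + 1), ∑ i : Fin (n + 1),
    if h : i < j then ((-1 : K) ^ (j : ℕ)) • PiTensorProduct.lift (L.term h.ne) else 0

theorem d_tprod (L : HomLeibniz K g) (n : ℕ) (x : Fin (n + 1) → g) :
    L.d n (PiTensorProduct.tprod K x) = ∑ j : Fin (n + 1), ∑ i : Fin (n + 1),
      if i < j then ((-1 : K) ^ (j : ℕ)) • PiTensorProduct.tprod K (L.slot i j x) else 0 := by
  simp only [d, LinearMap.sum_apply]
  refine Finset.sum_congr rfl fun j _ => Finset.sum_congr rfl fun i _ => ?_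
  split_ifs with h
  · rw [LinearMap.smul_apply, PiTensorProduct.lift.tprod]
    rfl
  · rfl

/-- The endomorphism `α^{⊗n}` of `g^{⊗n}`. -/
noncomputable def chainα (L : HomLeibniz K g) (n : ℕ) : (⨂[K]^n g) →ₗ[K] (⨂[K]^n g) :=
  PiTensorProduct.map fun _ => L.α

theorem d_chainα (L : HomLeibniz K g) (n : ℕ) (z : ⨂[K]^(n + 1) g) :
    L.d n (L.chainα (n + 1) z) = L.chainα n (L.d n z) := by
  suffices h : L.d n ∘ₗ L.chainα (n + 1) = L.chainα n ∘ₗ L.d n from LinearMap.congr_fun h z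
  refine PiTensorProduct.ext (MultilinearMap.ext fun x => ?_)
  simp only [LinearMap.compMultilinearMap_apply, LinearMap.comp_apply, chainα,
    PiTensorProduct.map_tprod, d_tprod, map_sum]
  refine Finset.sum_congr rfl fun j _ => Finset.sum_congr rfl fun i _ => ?_
  split_ifs with h
  · rw [map_smul, PiTensorProduct.map_tprod]
    congr 2
    funext k
    by_cases hk : j.succAbove k = i <;> simp [slot, hk, L.map_bracket]
  · simp

/-- The `n`-cycles; every `0`-chain is a cycle. -/
noncomputable def cycles (L : HomLeibniz K g) : (n : ℕ) → Submodule K (⨂[K]^n g)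
  | 0 => ⊤
  | n + 1 => LinearMap.ker (L.d n)

/-- The `n`-boundaries. -/
noncomputable def boundaries (L : HomLeibniz K g) (n : ℕ) : Submodule K (⨂[K]^n g) :=
  LinearMap.range (L.d n)

theorem chainα_mem_cycles (L : HomLeibniz K g) (n : ℕ) (z : ⨂[K]^n g) (hz : z ∈ L.cycles n) :
    L.chainα n z ∈ L.cycles n := by
  cases n with
  | zero => exact Submodule.mem_top
  | succ n =>
    have hz' : L.d n z = 0 := hz
    change L.d n _ = 0
    rw [d_chainα, hz', map_zero]

theorem chainα_mem_boundaries (L : HomLeibniz K g) (n : ℕ) (z : ⨂[K]^n g)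
    (hz : z ∈ L.boundaries n) : L.chainα n z ∈ L.boundaries n := by
  obtain ⟨y, rfl⟩ := hz
  exact ⟨L.chainα (n + 1) y, L.d_chainα n y⟩

/-- The `n`-th homology of `(g, α)` with trivial coefficients: cycles modulo boundaries. -/
abbrev HL (L : HomLeibniz K g) (n : ℕ) : Type _ :=
  ↥(L.cycles n) ⧸ (L.boundaries n).comap (L.cycles n).subtype

/-- The endomorphism of the `n`-th homology induced by `α^{⊗n}`, which makes the homology a
Hom-vector space. -/
noncomputable def HLα (L : HomLeibniz K g) (n : ℕ) : L.HL n →ₗ[K] L.HL n :=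
  Submodule.mapQ _ _ ((L.chainα n).restrict (L.chainα_mem_cycles n))
    fun z hz => L.chainα_mem_boundaries n z hz

end Homology

/-! ### Free Hom-Leibniz algebras, free presentations and the Schur multiplier -/

section Free

variable {K : Type u} [Field K]
variable {V : Type v} [AddCommGroup V] [Module K V]
variable {F : Type w} [AddCommGroup F] [Module K F]
variable {g : Type*} [AddCommGroup g] [Module K g]

/-- The Hom-Leibniz algebra `F` is free over the Hom-vector space `(V, αV)`, through the
homomorphism of Hom-vector spaces `ι : V → F`: every homomorphism of Hom-vector spaces from
`(V, αV)` to a Hom-Leibniz algebra extends uniquely to a homomorphism of Hom-Leibniz algebras. -/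
structure IsFreeOver (αV : V →ₗ[K] V) (LF : HomLeibniz K F) (ι : V →ₗ[K] F) : Prop where
  ι_α : ∀ x : V, ι (αV x) = LF.α (ι x)
  existsUnique_lift : ∀ (a : Type (max v w)) [AddCommGroup a] [Module K a] (A : HomLeibniz K a)
    (f : V →ₗ[K] a), (∀ x : V, f (αV x) = A.α (f x)) →
      ∃! φ : F →ₗ[K] a, LF.IsHom A φ ∧ ∀ x : V, φ (ι x) = f x

/-- `ker π ↣ F ↠ g` is a free presentation of the Hom-Leibniz algebra `L` on `g`. -/
structure IsFreePresentation (αV : V →ₗ[K] V) (LF : HomLeibniz K F) (ι : V →ₗ[K] F)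
    (L : HomLeibniz K g) (π : F →ₗ[K] g) : Prop where
  free : IsFreeOver αV LF ι
  isHom : LF.IsHom L π
  surjective : Function.Surjective π

/-- The Schur multiplier `(R ∩ [F, F]) / [F, R]` with `R = ker π`, as a vector space. -/
abbrev SchurMultiplier (LF : HomLeibniz K F) (π : F →ₗ[K] g) : Type _ :=
  ↥(LinearMap.ker π ⊓ LF.commutator ⊤ ⊤) ⧸
    (LF.commutator ⊤ (LinearMap.ker π)).comap (LinearMap.ker π ⊓ LF.commutator ⊤ ⊤).subtype

/-- The endomorphism of the Schur multiplier induced by the endomorphism of `F`. -/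
def schurα {LF : HomLeibniz K F} {L : HomLeibniz K g} {π : F →ₗ[K] g} (hπ : LF.IsHom L π) :
    SchurMultiplier LF π →ₗ[K] SchurMultiplier LF π :=
  Submodule.mapQ _ _
    (LF.α.restrict (p := LinearMap.ker π ⊓ LF.commutator ⊤ ⊤)
      (q := LinearMap.ker π ⊓ LF.commutator ⊤ ⊤) fun x hx =>
        ⟨by
          have h : π x = 0 := hx.1
          change π (LF.α x) = 0
          rw [hπ.map_α, h, map_zero],
        LF.commutator_α_mem _ _ x hx.2⟩)
    fun x hx => LF.commutator_α_mem _ _ x hx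

end Free

/-! ### Existence of free Hom-Leibniz algebras and of free presentations -/

section Existence

variable {K : Type u} [Field K] {V : Type v} [AddCommGroup V] [Module K V]

/-- The extension of `αV` to the free non-associative algebra on the set `V`. -/
noncomputable def preα (αV : V →ₗ[K] V) :
    FreeNonUnitalNonAssocAlgebra K V →ₙₐ[K] FreeNonUnitalNonAssocAlgebra K V :=
  FreeNonUnitalNonAssocAlgebra.lift K fun x => FreeNonUnitalNonAssocAlgebra.of K (αV x)

/-- The `α`-invariant two-sided ideals that contain the relations of linearity in the generators
and the Hom-Leibniz relations. -/
structure IsRelIdeal (αV : V →ₗ[K] V) (I : Submodule K (FreeNonUnitalNonAssocAlgebra K V)) :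
    Prop where
  add_rel : ∀ x y : V, FreeNonUnitalNonAssocAlgebra.of K (x + y) -
    (FreeNonUnitalNonAssocAlgebra.of K x + FreeNonUnitalNonAssocAlgebra.of K y) ∈ I
  smul_rel : ∀ (c : K) (x : V), FreeNonUnitalNonAssocAlgebra.of K (c • x) -
    c • FreeNonUnitalNonAssocAlgebra.of K x ∈ I
  leibniz_rel : ∀ x y z : FreeNonUnitalNonAssocAlgebra K V,
    preα αV x * (y * z) - ((x * y) * preα αV z - (x * z) * preα αV y) ∈ I
  mul_left : ∀ x y : FreeNonUnitalNonAssocAlgebra K V, y ∈ I → x * y ∈ I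
  mul_right : ∀ x y : FreeNonUnitalNonAssocAlgebra K V, x ∈ I → x * y ∈ I
  α_mem : ∀ x ∈ I, preα αV x ∈ I

/-- The ideal of relations of the free Hom-Leibniz algebra. -/
noncomputable def relIdeal (αV : V →ₗ[K] V) : Submodule K (FreeNonUnitalNonAssocAlgebra K V) :=
  sInf {I | IsRelIdeal αV I}

theorem relIdeal_isRelIdeal (αV : V →ₗ[K] V) : IsRelIdeal αV (relIdeal αV) where
  add_rel x y := Submodule.mem_sInf.2 fun _ hI => hI.add_rel x y
  smul_rel c x := Submodule.mem_sInf.2 fun _ hI => hI.smul_rel c x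
  leibniz_rel x y z := Submodule.mem_sInf.2 fun _ hI => hI.leibniz_rel x y z
  mul_left x y h := Submodule.mem_sInf.2 fun I hI => hI.mul_left x y (Submodule.mem_sInf.1 h I hI)
  mul_right x y h :=
    Submodule.mem_sInf.2 fun I hI => hI.mul_right x y (Submodule.mem_sInf.1 h I hI)
  α_mem x h := Submodule.mem_sInf.2 fun I hI => hI.α_mem x (Submodule.mem_sInf.1 h I hI)

/-- The underlying vector space of the free Hom-Leibniz algebra over `(V, αV)`. -/
abbrev FreeAlg (αV : V →ₗ[K] V) : Type (max u v) :=
  FreeNonUnitalNonAssocAlgebra K V ⧸ relIdeal αV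

/-- The product of the free non-associative algebra, with values in the quotient. -/
noncomputable def preBracket (αV : V →ₗ[K] V) : FreeNonUnitalNonAssocAlgebra K V →ₗ[K]
    FreeNonUnitalNonAssocAlgebra K V →ₗ[K] FreeAlg αV :=
  LinearMap.mk₂ K (fun x y => (relIdeal αV).mkQ (x * y))
    (fun x y z => by rw [add_mul, map_add]) (fun c x y => by rw [smul_mul_assoc, map_smul])
    (fun x y z => by rw [mul_add, map_add]) (fun c x y => by rw [mul_smul_comm, map_smul])

theorem preBracket_right (αV : V →ₗ[K] V) (x y : FreeNonUnitalNonAssocAlgebra K V)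
    (hy : y ∈ relIdeal αV) : preBracket αV x y = 0 :=
  (Submodule.Quotient.mk_eq_zero _).2 ((relIdeal_isRelIdeal αV).mul_left x y hy)

theorem preBracket_left (αV : V →ₗ[K] V) (x y : FreeNonUnitalNonAssocAlgebra K V)
    (hx : x ∈ relIdeal αV) : preBracket αV x y = 0 :=
  (Submodule.Quotient.mk_eq_zero _).2 ((relIdeal_isRelIdeal αV).mul_right x y hx)

/-- The product of the free Hom-Leibniz algebra. -/
noncomputable def freeBracket (αV : V →ₗ[K] V) :
    FreeAlg αV →ₗ[K] FreeAlg αV →ₗ[K] FreeAlg αV :=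
  (relIdeal αV).liftQ
    ((relIdeal αV).liftQ (preBracket αV).flip fun y hy =>
      LinearMap.mem_ker.2 (LinearMap.ext fun x => preBracket_right αV x y hy)).flip
    fun x hx => LinearMap.mem_ker.2 (LinearMap.ext fun y => by
      induction y using Submodule.Quotient.induction_on with | H y => ?_
      exact preBracket_left αV x y hx)

/-- The free Hom-Leibniz algebra over `(V, αV)`. -/
noncomputable def freeStructure (αV : V →ₗ[K] V) : HomLeibniz K (FreeAlg αV) where
  bracket := freeBracket αV
  α := (relIdeal αV).mapQ (relIdeal αV)
    (((preα αV : FreeNonUnitalNonAssocAlgebra K V →ₙₐ[K] FreeNonUnitalNonAssocAlgebra K V) :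
      FreeNonUnitalNonAssocAlgebra K V →ₗ[K] FreeNonUnitalNonAssocAlgebra K V))
    fun x hx => Submodule.mem_comap.2 ((relIdeal_isRelIdeal αV).α_mem x hx)
  hom_leibniz x y z := by
    induction x using Submodule.Quotient.induction_on with | H x => ?_
    induction y using Submodule.Quotient.induction_on with | H y => ?_
    induction z using Submodule.Quotient.induction_on with | H z => ?_
    exact (Submodule.Quotient.eq _).2 ((relIdeal_isRelIdeal αV).leibniz_rel x y z)
  map_bracket x y := by
    induction x using Submodule.Quotient.induction_on with | H x => ?_
    induction y using Submodule.Quotient.induction_on with | H y => ?_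
    exact congrArg (relIdeal αV).mkQ (map_mul (preα αV) x y)

/-- The inclusion of the generators. -/
noncomputable def freeι (αV : V →ₗ[K] V) : V →ₗ[K] FreeAlg αV where
  toFun x := (relIdeal αV).mkQ (FreeNonUnitalNonAssocAlgebra.of K x)
  map_add' x y := (Submodule.Quotient.eq _).2 ((relIdeal_isRelIdeal αV).add_rel x y)
  map_smul' c x := (Submodule.Quotient.eq _).2 ((relIdeal_isRelIdeal αV).smul_rel c x)

theorem freeStructure_lift (αV : V →ₗ[K] V) {a : Type w} [AddCommGroup a] [Module K a]
    (A : HomLeibniz K a) (f : V →ₗ[K] a) (hf : ∀ x : V, f (αV x) = A.α (f x)) :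
    ∃! φ : FreeAlg αV →ₗ[K] a, (freeStructure αV).IsHom A φ ∧ ∀ x : V, φ (freeι αV x) = f x := by
  let _ : NonUnitalNonAssocRing a :=
    { (inferInstance : AddCommGroup a) with
      mul := fun x y => A.bracket x y
      left_distrib := fun x y z => map_add (A.bracket x) y z
      right_distrib := fun x y z => LinearMap.map_add₂ A.bracket x y z
      zero_mul := fun x => LinearMap.map_zero₂ A.bracket x
      mul_zero := fun x => map_zero (A.bracket x) }
  have : IsScalarTower K a a := ⟨fun c x y => LinearMap.map_smul₂ A.bracket c x y⟩
  have : SMulCommClass K a a := ⟨fun c x y => (map_smul (A.bracket x) c y).symm⟩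
  have mul_def : ∀ x y : a, x * y = A.bracket x y := fun _ _ => rfl
  let Φ : FreeNonUnitalNonAssocAlgebra K V →ₙₐ[K] a := FreeNonUnitalNonAssocAlgebra.lift K f
  have Φ_of : ∀ x : V, Φ (FreeNonUnitalNonAssocAlgebra.of K x) = f x :=
    FreeNonUnitalNonAssocAlgebra.lift_of_apply K f
  let Aα : a →ₙₐ[K] a :=
    { toFun := A.α
      map_smul' := fun c x => map_smul A.α c x
      map_zero' := map_zero A.α
      map_add' := map_add A.α
      map_mul' := A.map_bracket }
  have Φ_α : ∀ x, Φ (preα αV x) = A.α (Φ x) := by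
    suffices h : Φ.comp (preα αV) = Aα.comp Φ from fun x => DFunLike.congr_fun h x
    refine FreeNonUnitalNonAssocAlgebra.hom_ext K fun x => ?_
    change Φ (preα αV (FreeNonUnitalNonAssocAlgebra.of K x)) =
      A.α (Φ (FreeNonUnitalNonAssocAlgebra.of K x))
    rw [Φ_of, preα, FreeNonUnitalNonAssocAlgebra.lift_of_apply, Φ_of, hf]
  let Φl : FreeNonUnitalNonAssocAlgebra K V →ₗ[K] a := (Φ : _ →ₗ[K] a)
  have Φl_apply : ∀ x, Φl x = Φ x := fun _ => rfl
  have hker : relIdeal αV ≤ LinearMap.ker Φl := by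
    refine sInf_le ⟨?_, ?_, ?_, ?_, ?_, ?_⟩
    · intro x y
      simp only [LinearMap.mem_ker, Φl_apply, map_sub, map_add, Φ_of, sub_self]
    · intro c x
      simp only [LinearMap.mem_ker, Φl_apply, map_sub, map_smul, Φ_of, sub_self]
    · intro x y z
      simp only [LinearMap.mem_ker, Φl_apply, map_sub, map_mul, Φ_α, mul_def, A.hom_leibniz,
        sub_self]
    · intro x y hy
      simp only [LinearMap.mem_ker, Φl_apply] at hy ⊢
      rw [map_mul, hy, mul_zero]
    · intro x y hx
      simp only [LinearMap.mem_ker, Φl_apply] at hx ⊢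
      rw [map_mul, hx, zero_mul]
    · intro x hx
      simp only [LinearMap.mem_ker, Φl_apply] at hx ⊢
      rw [Φ_α, hx, map_zero]
  refine ⟨(relIdeal αV).liftQ Φl hker, ⟨⟨fun x y => ?_, fun x => ?_⟩, fun x => Φ_of x⟩, ?_⟩
  · induction x using Submodule.Quotient.induction_on with | H x => ?_
    induction y using Submodule.Quotient.induction_on with | H y => ?_
    exact map_mul Φ x y
  · induction x using Submodule.Quotient.induction_on with | H x => ?_
    exact Φ_α x
  · rintro ψ ⟨hψ, hψι⟩
    let Ψ : FreeNonUnitalNonAssocAlgebra K V →ₙₐ[K] a :=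
      { toFun := fun x => ψ ((relIdeal αV).mkQ x)
        map_smul' := fun c x => by simp only [map_smul, MonoidHom.id_apply]
        map_zero' := by simp only [map_zero]
        map_add' := fun x y => by simp only [map_add]
        map_mul' := fun x y => hψ.map_bracket ((relIdeal αV).mkQ x) ((relIdeal αV).mkQ y) }
    have hΨ : Ψ = Φ := FreeNonUnitalNonAssocAlgebra.hom_ext K
      fun x => (hψι x).trans (Φ_of x).symm
    refine LinearMap.ext fun x => ?_
    induction x using Submodule.Quotient.induction_on with | H x => ?_
    exact DFunLike.congr_fun hΨ x

theorem freeStructure_isFreeOver (αV : V →ₗ[K] V) :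
    IsFreeOver αV (freeStructure αV) (freeι αV) where
  ι_α x := by
    change _ = (relIdeal αV).mkQ (preα αV (FreeNonUnitalNonAssocAlgebra.of K x))
    rw [preα, FreeNonUnitalNonAssocAlgebra.lift_of_apply]
    rfl
  existsUnique_lift _ _ _ A f hf := freeStructure_lift αV A f hf

/-- Every Hom-Leibniz algebra has a free presentation. -/
theorem exists_isFreePresentation (L : HomLeibniz K V) :
    ∃ π : FreeAlg L.α →ₗ[K] V,
      IsFreePresentation L.α (freeStructure L.α) (freeι L.α) L π := by
  obtain ⟨π, ⟨hπ, hι⟩, -⟩ := freeStructure_lift L.α L LinearMap.id (fun _ => rfl)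
  exact ⟨π, freeStructure_isFreeOver L.α, hπ, fun x => ⟨freeι L.α x, hι x⟩⟩

end Existence

end HomLeibniz

/-! Let `Q(g)` be `g ⊗ g` modulo the Hom-Leibniz relators. These relators are exactly the values of
`d₃` on pure tensors, and `d₂` is minus the product, so `HL₂(g)` is the kernel of the product map
`Q(g) → g`.

Freeness enters only through `IsFreeOver.exists_squareMk`: for free `f` the map `Q(f) → f` has a
linear retraction. It comes from a Hom-Leibniz structure on `V × Q(f)` through which the identity of
`f` factors.

Following this retraction by `Q(π)` gives a linear `σ : f → Q(g)` with `σ [x, y] = π x ⊗ π y`, so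
`σ` kills `[f, r]`. In the other direction, a linear section `t` of `π` gives `τ (x ⊗ y) = [t x, t
y]`. A change of lifts alters a product only by an element of `[f, r]`
(`bracket_sub_bracket_mem_commutator`). Hence modulo `[f, r]` the map `τ` kills boundaries, commutes
with the self-maps and has image `[f, f]`. Since `σ ∘ τ` is the quotient map and `π ∘ τ` is the
product, `τ` induces the isomorphism from cycles modulo boundaries. -/

namespace HomLeibniz

/-! ### Commutators with an ideal. -/

section Commutator

variable {K : Type*} [Field K] {g : Type*} [AddCommGroup g] [Module K g] (L : HomLeibniz K g)

theorem bracket_mem_commutator_left {H H' : Submodule K g} {h k : g} (hh : h ∈ H) (hk : k ∈ H') :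
    L.bracket h k ∈ L.commutator H H' :=
  Submodule.mem_sInf.2 fun _ hS => (hS.2 h hh k hk).1

theorem bracket_mem_commutator_right {H H' : Submodule K g} {h k : g} (hh : h ∈ H) (hk : k ∈ H') :
    L.bracket k h ∈ L.commutator H H' :=
  Submodule.mem_sInf.2 fun _ hS => (hS.2 h hh k hk).2

/-- For an `α`-invariant two-sided ideal `R`, the commutator `[g, R]` is contained in every
subspace that contains the products of elements of `R` with elements of `g`. -/
theorem commutator_top_le {R S : Submodule K g} (hα : ∀ r ∈ R, L.α r ∈ R)
    (hl : ∀ x, ∀ r ∈ R, L.bracket x r ∈ R) (hr : ∀ x, ∀ r ∈ R, L.bracket r x ∈ R)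
    (hS : ∀ x, ∀ r ∈ R, L.bracket x r ∈ S ∧ L.bracket r x ∈ S) :
    L.commutator ⊤ R ≤ S := by
  let P : Set g := {c | ∃ x, ∃ r ∈ R, c = L.bracket x r ∨ c = L.bracket r x}
  have hPR : Submodule.span K P ≤ R := by
    refine Submodule.span_le.2 ?_
    rintro c ⟨x, r, h, rfl | rfl⟩
    exacts [hl x r h, hr x r h]
  -- Since `span P ≤ R`, a product of two elements of `span P` is again of the form `[x, r]`. The
  -- linear span is therefore already a subalgebra, and no iterated products are needed.
  have hP : L.commutator ⊤ R ≤ Submodule.span K P := by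
    refine sInf_le ⟨⟨fun x _ y hy => Submodule.subset_span ⟨x, y, hPR hy, .inl rfl⟩, ?_⟩,
      fun x _ r h => ⟨Submodule.subset_span ⟨x, r, h, .inl rfl⟩,
        Submodule.subset_span ⟨x, r, h, .inr rfl⟩⟩⟩
    suffices h : Submodule.span K P ≤ (Submodule.span K P).comap L.α from fun x hx => h hx
    refine Submodule.span_le.2 ?_
    rintro c ⟨x, r, h, rfl | rfl⟩
    · exact Submodule.subset_span ⟨L.α x, L.α r, hα r h, .inl (L.map_bracket _ _)⟩
    · exact Submodule.subset_span ⟨L.α x, L.α r, hα r h, .inr (L.map_bracket _ _)⟩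
  refine hP.trans (Submodule.span_le.2 ?_)
  rintro c ⟨x, r, h, rfl | rfl⟩
  exacts [(hS x r h).1, (hS x r h).2]

variable {g' : Type*} [AddCommGroup g'] [Module K g'] {L} {L' : HomLeibniz K g'} {π : g →ₗ[K] g'}

theorem IsHom.commutator_top_ker_le (hπ : L.IsHom L' π) {S : Submodule K g}
    (hS : ∀ x, ∀ r ∈ LinearMap.ker π, L.bracket x r ∈ S ∧ L.bracket r x ∈ S) :
    L.commutator ⊤ (LinearMap.ker π) ≤ S := by
  refine L.commutator_top_le (fun r h => ?_) (fun x r h => ?_) (fun x r h => ?_) hS <;>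
    rw [LinearMap.mem_ker] at h ⊢
  · rw [hπ.map_α, h, map_zero]
  · rw [hπ.map_bracket, h, map_zero]
  · rw [hπ.map_bracket, h, map_zero, LinearMap.zero_apply]

theorem IsHom.commutator_top_ker_le_ker (hπ : L.IsHom L' π) :
    L.commutator ⊤ (LinearMap.ker π) ≤ LinearMap.ker π := by
  refine hπ.commutator_top_ker_le fun x r h => ?_
  rw [LinearMap.mem_ker] at h
  simp [LinearMap.mem_ker, hπ.map_bracket, h]

/-- Independence of the choice of lifts: this makes up for a linear section of `π` respecting
neither the product nor `α`. -/
theorem bracket_sub_bracket_mem_commutator {x x' y y' : g} (hx : π x = π x') (hy : π y = π y') :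
    L.bracket x y - L.bracket x' y' ∈ L.commutator ⊤ (LinearMap.ker π) := by
  have h : L.bracket x y - L.bracket x' y' = L.bracket (x - x') y + L.bracket x' (y - y') := by
    simp only [map_sub, LinearMap.sub_apply]
    abel
  rw [h]
  exact add_mem
    (L.bracket_mem_commutator_right Submodule.mem_top (LinearMap.sub_mem_ker_iff.2 hx))
    (L.bracket_mem_commutator_left Submodule.mem_top (LinearMap.sub_mem_ker_iff.2 hy))

end Commutator

/-! ### The tensor square modulo the Hom-Leibniz relators. -/

section TensorSquare

variable {K : Type*} [Field K] {g : Type*} [AddCommGroup g] [Module K g] (L : HomLeibniz K g)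

/-- The subspace of `g ⊗ g` spanned by the Hom-Leibniz relators. -/
def relators : Submodule K (g ⊗[K] g) :=
  Submodule.span K {t | ∃ x y z : g, t = L.α x ⊗ₜ[K] L.bracket y z -
    (L.bracket x y ⊗ₜ[K] L.α z - L.bracket x z ⊗ₜ[K] L.α y)}

/-- The tensor square of `g` modulo the Hom-Leibniz relators. -/
abbrev LeibnizSquare : Type _ := (g ⊗[K] g) ⧸ L.relators

/-- Descend a bilinear map satisfying the Hom-Leibniz relation to `LeibnizSquare`. -/
noncomputable def squareLift {M : Type*} [AddCommGroup M] [Module K M] (f : g →ₗ[K] g →ₗ[K] M)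
    (hf : ∀ x y z, f (L.α x) (L.bracket y z) =
      f (L.bracket x y) (L.α z) - f (L.bracket x z) (L.α y)) : L.LeibnizSquare →ₗ[K] M :=
  L.relators.liftQ (TensorProduct.lift f) <| Submodule.span_le.2 <| by
    rintro t ⟨x, y, z, rfl⟩
    simp [hf]

/-- The universal bilinear map to `LeibnizSquare`. -/
noncomputable def squareMk : g →ₗ[K] g →ₗ[K] L.LeibnizSquare :=
  (TensorProduct.mk K g g).compr₂ L.relators.mkQ

theorem squareLift_mk {M : Type*} [AddCommGroup M] [Module K M] (f : g →ₗ[K] g →ₗ[K] M)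
    (hf : ∀ x y z, f (L.α x) (L.bracket y z) =
      f (L.bracket x y) (L.α z) - f (L.bracket x z) (L.α y)) (x y : g) :
    L.squareLift f hf (L.squareMk x y) = f x y :=
  TensorProduct.lift.tmul x y

theorem squareMk_leibniz (x y z : g) : L.squareMk (L.α x) (L.bracket y z) =
    L.squareMk (L.bracket x y) (L.α z) - L.squareMk (L.bracket x z) (L.α y) :=
  (Submodule.Quotient.eq _).2 (Submodule.subset_span ⟨x, y, z, rfl⟩)

/-- The endomorphism of `LeibnizSquare` induced by `α ⊗ α`. -/
noncomputable def squareα : L.LeibnizSquare →ₗ[K] L.LeibnizSquare :=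
  L.squareLift (L.squareMk.compl₁₂ L.α L.α) fun x y z => by
    simp [L.map_bracket, L.squareMk_leibniz]

theorem squareα_mk (x y : g) : L.squareα (L.squareMk x y) = L.squareMk (L.α x) (L.α y) :=
  L.squareLift_mk _ _ x y

/-- The product, as a map on `LeibnizSquare`. -/
noncomputable def squareBracket : L.LeibnizSquare →ₗ[K] g :=
  L.squareLift L.bracket L.hom_leibniz

theorem squareBracket_mk (x y : g) : L.squareBracket (L.squareMk x y) = L.bracket x y :=
  L.squareLift_mk _ _ x y

theorem squareBracket_α (t : L.LeibnizSquare) :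
    L.squareBracket (L.squareα t) = L.α (L.squareBracket t) := by
  suffices h : L.squareBracket ∘ₗ L.squareα = L.α ∘ₗ L.squareBracket from LinearMap.congr_fun h t
  refine Submodule.linearMap_qext _ (TensorProduct.ext' fun x y => ?_)
  change L.squareBracket (L.squareα (L.squareMk x y)) = L.α (L.squareBracket (L.squareMk x y))
  rw [squareα_mk, squareBracket_mk, squareBracket_mk, L.map_bracket]

end TensorSquare

/-! ### Splitting the product map of a free Hom-Leibniz algebra. -/

section FreeSplitting

variable {K : Type*} [Field K] {V : Type v} [AddCommGroup V] [Module K V]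
variable {F : Type w} [AddCommGroup F] [Module K F]

/-- The Hom-Leibniz algebra `V × LeibnizSquare`, with product `[u, u'] = (0, p u ⊗ p u')` where
`p (v, t)` is the sum of `ι v` and the product of `t`. -/
noncomputable def squareExtension (LF : HomLeibniz K F) (αV : V →ₗ[K] V) (ι : V →ₗ[K] F)
    (hι : ∀ x, ι (αV x) = LF.α (ι x)) : HomLeibniz K (V × LF.LeibnizSquare) where
  bracket := (LF.squareMk.compr₂ (LinearMap.inr K V LF.LeibnizSquare)).compl₁₂
    (ι.coprod LF.squareBracket) (ι.coprod LF.squareBracket)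
  α := αV.prodMap LF.squareα
  hom_leibniz x y z := by
    -- The map `p` preserves products and commutes with the self-maps, so the identity in the second
    -- component is the relator at `p x`, `p y`, `p z`.
    have h := LF.squareMk_leibniz (ι x.1 + LF.squareBracket x.2) (ι y.1 + LF.squareBracket y.2)
      (ι z.1 + LF.squareBracket z.2)
    ext
    · simp
    · simpa [hι, squareBracket_α, squareBracket_mk] using h
  map_bracket x y := by
    ext
    · simp
    · simp [hι, squareBracket_α, squareα_mk]

/-- A Hom-Leibniz algebra, lifted to a higher universe. -/
def ulift (L : HomLeibniz K F) : HomLeibniz K (ULift.{v} F) where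
  bracket := (L.bracket.compr₂ ULift.moduleEquiv.symm.toLinearMap).compl₁₂
    ULift.moduleEquiv.toLinearMap ULift.moduleEquiv.toLinearMap
  α := ULift.moduleEquiv.symm.toLinearMap ∘ₗ L.α ∘ₗ ULift.moduleEquiv.toLinearMap
  hom_leibniz x y z := ULift.ext _ _ (L.hom_leibniz x.down y.down z.down)
  map_bracket x y := ULift.ext _ _ (L.map_bracket x.down y.down)

/-- Uniqueness of lifts, applied to the target `F` itself. The universal property only tests targets
in universe `max v w`, whence the passage through `ULift`. -/
theorem IsFreeOver.hom_ext_self {αV : V →ₗ[K] V} {LF : HomLeibniz K F} {ι : V →ₗ[K] F}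
    (h : IsFreeOver αV LF ι) {φ : F →ₗ[K] F} (hφ : LF.IsHom LF φ) (hφι : ∀ x, φ (ι x) = ι x) :
    φ = LinearMap.id := by
  let e : F →ₗ[K] ULift.{v} F := ULift.moduleEquiv.symm.toLinearMap
  have he := (h.existsUnique_lift (ULift.{v} F) (ulift.{v} LF) (e ∘ₗ ι)
    fun x => congrArg e (h.ι_α x)).unique
    (y₁ := e ∘ₗ φ) (y₂ := e)
    ⟨⟨fun x y => congrArg e (hφ.map_bracket x y), fun x => congrArg e (hφ.map_α x)⟩,
      fun x => congrArg e (hφι x)⟩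
    ⟨⟨fun x y => rfl, fun x => rfl⟩, fun x => rfl⟩
  exact LinearMap.ext fun x => congrArg ULift.down (LinearMap.congr_fun he x)

/-- In a free Hom-Leibniz algebra, the product of `LeibnizSquare` has a linear left inverse. This
amounts to the vanishing of the second homology. -/
theorem IsFreeOver.exists_squareMk {αV : V →ₗ[K] V} {LF : HomLeibniz K F} {ι : V →ₗ[K] F}
    (h : IsFreeOver αV LF ι) :
    ∃ σ : F →ₗ[K] LF.LeibnizSquare, ∀ x y, σ (LF.bracket x y) = LF.squareMk x y := by
  let U := squareExtension LF αV ι h.ι_α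
  let p : V × LF.LeibnizSquare →ₗ[K] F := ι.coprod LF.squareBracket
  have U_bracket : ∀ u u', U.bracket u u' = (0, LF.squareMk (p u) (p u')) := fun _ _ => rfl
  have hp : U.IsHom LF p :=
    ⟨fun u u' => by simp [U_bracket, p, squareBracket_mk],
      fun u => by simp [U, p, squareExtension, h.ι_α, squareBracket_α]⟩
  obtain ⟨s, ⟨hs, hsι⟩, -⟩ := h.existsUnique_lift _ U (LinearMap.inl K V LF.LeibnizSquare)
    fun x => by simp [U, squareExtension]
  -- Both sides are endomorphisms of `F` that fix the generators.
  have hps : p ∘ₗ s = LinearMap.id := h.hom_ext_self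
    ⟨fun x y => by simp only [LinearMap.comp_apply, hs.map_bracket, hp.map_bracket],
      fun x => by simp only [LinearMap.comp_apply, hs.map_α, hp.map_α]⟩
    fun x => by simp [hsι, p]
  have hps' : ∀ x, p (s x) = x := LinearMap.congr_fun hps
  -- `s [x, y] = [s x, s y] = (0, p (s x) ⊗ p (s y)) = (0, x ⊗ y)`.
  exact ⟨LinearMap.snd K V _ ∘ₗ s, fun x y => by simp [hs.map_bracket, U_bracket, hps']⟩

end FreeSplitting

/-! ### The chain complex in degrees one to three. -/

section LowDegrees

variable {K : Type*} [Field K] {g : Type*} [AddCommGroup g] [Module K g] (L : HomLeibniz K g)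

theorem d_one_tprod (x : Fin 2 → g) : L.d 1 (PiTensorProduct.tprod K x) =
    -PiTensorProduct.tprod K ![L.bracket (x 0) (x 1)] := by
  have h : L.slot 0 1 x = ![L.bracket (x 0) (x 1)] := by
    funext k
    fin_cases k
    simp [slot]
  simp [d_tprod, Fin.sum_univ_two, h]

/-- With factors numbered from `0`, the pair `(0, 1)` has sign `-1` and the pairs with `j = 2` have
sign `+1`; grouped this way, the value is a Hom-Leibniz relator. -/
theorem d_two_tprod (x : Fin 3 → g) : L.d 2 (PiTensorProduct.tprod K x) =
    PiTensorProduct.tprod K ![L.α (x 0), L.bracket (x 1) (x 2)] -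
      (PiTensorProduct.tprod K ![L.bracket (x 0) (x 1), L.α (x 2)] -
        PiTensorProduct.tprod K ![L.bracket (x 0) (x 2), L.α (x 1)]) := by
  have h₁ : L.slot 0 1 x = ![L.bracket (x 0) (x 1), L.α (x 2)] := by
    funext k
    fin_cases k <;> simp [slot, Fin.succAbove, Fin.ext_iff]
  have h₂ : L.slot 0 2 x = ![L.bracket (x 0) (x 2), L.α (x 1)] := by
    funext k
    fin_cases k <;> simp [slot, Fin.succAbove, Fin.lt_def]
  have h₃ : L.slot 1 2 x = ![L.α (x 0), L.bracket (x 1) (x 2)] := by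
    funext k
    fin_cases k <;> simp [slot, Fin.succAbove, Fin.lt_def]
  simp [d_tprod, Fin.sum_univ_three, h₁, h₂, h₃]
  abel

theorem update_vecCons_zero {X : Type*} (x y a : X) :
    Function.update ![x, y] 0 a = ![a, y] := by
  funext k
  fin_cases k <;> rfl

theorem update_vecCons_one {X : Type*} (x y a : X) :
    Function.update ![x, y] 1 a = ![x, a] := by
  funext k
  fin_cases k <;> rfl

/-- The pure tensor `x ⊗ y` in `g^{⊗2}`, as a bilinear map. -/
noncomputable def tprodTwo : g →ₗ[K] g →ₗ[K] ⨂[K]^2 g :=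
  LinearMap.mk₂ K (fun x y => PiTensorProduct.tprod K ![x, y])
    (fun x x' y => by
      have h := (PiTensorProduct.tprod K (s := fun _ : Fin 2 => g)).map_update_add ![x, y] 0 x x'
      rwa [update_vecCons_zero, update_vecCons_zero, update_vecCons_zero] at h)
    (fun c x y => by
      have h := (PiTensorProduct.tprod K (s := fun _ : Fin 2 => g)).map_update_smul ![x, y] 0 c x
      rwa [update_vecCons_zero, update_vecCons_zero] at h)
    (fun x y y' => by
      have h := (PiTensorProduct.tprod K (s := fun _ : Fin 2 => g)).map_update_add ![x, y] 1 y y'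
      rwa [update_vecCons_one, update_vecCons_one, update_vecCons_one] at h)
    (fun c x y => by
      have h := (PiTensorProduct.tprod K (s := fun _ : Fin 2 => g)).map_update_smul ![x, y] 1 c y
      rwa [update_vecCons_one, update_vecCons_one] at h)

theorem tprodTwo_apply (x y : g) :
    tprodTwo (K := K) x y = PiTensorProduct.tprod K ![x, y] := rfl

theorem tprod_fin_two (x : Fin 2 → g) : PiTensorProduct.tprod K x = tprodTwo (x 0) (x 1) := by
  rw [tprodTwo_apply]
  congr 1
  funext k
  fin_cases k <;> rfl

/-- A bilinear map, as a linear map on `g^{⊗2}`. -/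
noncomputable def tprodTwoLift {M : Type*} [AddCommGroup M] [Module K M]
    (f : g →ₗ[K] g →ₗ[K] M) : (⨂[K]^2 g) →ₗ[K] M :=
  PiTensorProduct.lift <| MultilinearMap.mk' (fun x : Fin 2 → g => f (x 0) (x 1))
    (by intro x m a b; fin_cases m <;> simp)
    (by intro x m c a; fin_cases m <;> simp)

theorem tprodTwoLift_tprodTwo {M : Type*} [AddCommGroup M] [Module K M]
    (f : g →ₗ[K] g →ₗ[K] M) (x y : g) : tprodTwoLift f (tprodTwo x y) = f x y :=
  PiTensorProduct.lift.tprod (R := K) (s := fun _ : Fin 2 => g) ![x, y]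

theorem tprodTwo_hom_ext {M : Type*} [AddCommGroup M] [Module K M] {f f' : (⨂[K]^2 g) →ₗ[K] M}
    (h : ∀ x y, f (tprodTwo x y) = f' (tprodTwo x y)) : f = f' := by
  refine PiTensorProduct.ext (MultilinearMap.ext fun x => ?_)
  simp only [LinearMap.compMultilinearMap_apply, tprod_fin_two, h]

theorem chainα_tprodTwo (x y : g) :
    L.chainα 2 (tprodTwo x y) = tprodTwo (L.α x) (L.α y) := by
  rw [tprodTwo_apply, chainα, PiTensorProduct.map_tprod, tprod_fin_two]
  rfl

theorem tprodTwo_leibniz_mem_boundaries (x y z : g) :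
    tprodTwo (L.α x) (L.bracket y z) -
      (tprodTwo (L.bracket x y) (L.α z) - tprodTwo (L.bracket x z) (L.α y)) ∈ L.boundaries 2 :=
  ⟨PiTensorProduct.tprod K ![x, y, z], by rw [d_two_tprod]; rfl⟩

theorem boundaries_two_le {S : Submodule K (⨂[K]^2 g)}
    (hS : ∀ x y z, tprodTwo (L.α x) (L.bracket y z) -
      (tprodTwo (L.bracket x y) (L.α z) - tprodTwo (L.bracket x z) (L.α y)) ∈ S) :
    L.boundaries 2 ≤ S := by
  suffices h : S.mkQ ∘ₗ L.d 2 = 0 by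
    rintro _ ⟨w, rfl⟩
    exact (Submodule.Quotient.mk_eq_zero S).1 (LinearMap.congr_fun h w)
  refine PiTensorProduct.ext (MultilinearMap.ext fun x => ?_)
  refine (Submodule.Quotient.mk_eq_zero S).2 ?_
  rw [d_two_tprod]
  exact hS (x 0) (x 1) (x 2)

/-- Under `g^{⊗1} ≃ g` the boundary map becomes minus the product. -/
theorem mem_cycles_two {z : ⨂[K]^2 g} : z ∈ L.cycles 2 ↔ tprodTwoLift L.bracket z = 0 := by
  let e : (⨂[K]^1 g) ≃ₗ[K] g := PiTensorProduct.subsingletonEquiv (0 : Fin 1)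
  have h : e.toLinearMap ∘ₗ L.d 1 = -tprodTwoLift L.bracket := tprodTwo_hom_ext fun x y => by
    rw [LinearMap.neg_apply, tprodTwoLift_tprodTwo, tprodTwo_apply, LinearMap.comp_apply,
      d_one_tprod, map_neg]
    exact congrArg Neg.neg (PiTensorProduct.subsingletonEquiv_apply_tprod _ _)
  have hz : e (L.d 1 z) = -tprodTwoLift L.bracket z := LinearMap.congr_fun h z
  change L.d 1 z = 0 ↔ _
  rw [← e.map_eq_zero_iff, hz, neg_eq_zero]

end LowDegrees

end HomLeibniz

/-! ### Hopf's formula. -/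

open HomLeibniz in
theorem corollary4p5 {K : Type*} [Field K]
    {g : Type*} [AddCommGroup g] [Module K g] (L : HomLeibniz K g)
    {V : Type*} [AddCommGroup V] [Module K V] (αV : V →ₗ[K] V)
    {F : Type*} [AddCommGroup F] [Module K F] (LF : HomLeibniz K F)
    (ι : V →ₗ[K] F) (π : F →ₗ[K] g)
    (hP : HomLeibniz.IsFreePresentation αV LF ι L π) :
    ∃ e : L.HL 2 ≃ₗ[K] HomLeibniz.SchurMultiplier LF π,
      ∀ z : L.HL 2, e (L.HLα 2 z) = HomLeibniz.schurα hP.isHom (e z) := by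
  have hπ := hP.isHom
  obtain ⟨t, ht⟩ := π.exists_rightInverse_of_surjective (LinearMap.range_eq_top.2 hP.surjective)
  replace ht : ∀ x, π (t x) = x := LinearMap.congr_fun ht
  obtain ⟨σ₀, hσ₀⟩ := hP.free.exists_squareMk
  let C := LF.commutator ⊤ (LinearMap.ker π)
  let N := LinearMap.ker π ⊓ LF.commutator ⊤ ⊤
  -- `σ [x, y]` is the class of `π x ⊗ π y`
  let σ : F →ₗ[K] (⨂[K]^2 g) ⧸ L.boundaries 2 :=
    LF.squareLift ((tprodTwo.compl₁₂ π π).compr₂ (L.boundaries 2).mkQ) (fun x y z => by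
      refine (Submodule.Quotient.eq _).2 ?_
      simpa [hπ.map_bracket, hπ.map_α] using
        L.tprodTwo_leibniz_mem_boundaries (π x) (π y) (π z)) ∘ₗ σ₀
  have hσ : ∀ x y, σ (LF.bracket x y) = (L.boundaries 2).mkQ (tprodTwo (π x) (π y)) := by
    intro x y
    simp only [σ, LinearMap.comp_apply, hσ₀]
    rfl
  have hσC : C ≤ LinearMap.ker σ := hπ.commutator_top_ker_le fun x r hr => by
    rw [LinearMap.mem_ker] at hr
    simp only [LinearMap.mem_ker, hσ, hr, map_zero, LinearMap.zero_apply, and_self]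
  let τ : (⨂[K]^2 g) →ₗ[K] F := tprodTwoLift (LF.bracket.compl₁₂ t t)
  have hτ : ∀ x y, τ (tprodTwo x y) = LF.bracket (t x) (t y) := tprodTwoLift_tprodTwo _
  have hστ : ∀ z, σ (τ z) = (L.boundaries 2).mkQ z := LinearMap.congr_fun
    (f := σ ∘ₗ τ) <| tprodTwo_hom_ext fun x y => by
      rw [LinearMap.comp_apply, hτ, hσ, ht, ht]
  have hπτ : ∀ z, π (τ z) = tprodTwoLift L.bracket z := LinearMap.congr_fun
    (f := π ∘ₗ τ) <| tprodTwo_hom_ext fun x y => by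
      rw [LinearMap.comp_apply, hτ, hπ.map_bracket, ht, ht, tprodTwoLift_tprodTwo]
  have hτcomm : ∀ z, τ z ∈ LF.commutator ⊤ ⊤ := by
    intro z
    have h : (LF.commutator ⊤ ⊤).mkQ ∘ₗ τ = 0 := tprodTwo_hom_ext fun x y =>
      (Submodule.Quotient.mk_eq_zero _).2 <| by
        rw [hτ]
        exact LF.bracket_mem_commutator_left Submodule.mem_top Submodule.mem_top
    exact (Submodule.Quotient.mk_eq_zero _).1 (LinearMap.congr_fun h z)
  have hτα : ∀ z, τ (L.chainα 2 z) - LF.α (τ z) ∈ C := by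
    intro z
    have h : C.mkQ ∘ₗ τ ∘ₗ L.chainα 2 = C.mkQ ∘ₗ LF.α ∘ₗ τ := tprodTwo_hom_ext fun x y =>
      (Submodule.Quotient.eq _).2 <| by
        simp only [LinearMap.comp_apply, chainα_tprodTwo, hτ, LF.map_bracket]
        exact bracket_sub_bracket_mem_commutator (by rw [hπ.map_α, ht, ht])
          (by rw [hπ.map_α, ht, ht])
    exact (Submodule.Quotient.eq _).1 (LinearMap.congr_fun h z)
  -- Modulo `C`, the lifts `t (α x)` and `t [y, z]` may be replaced by `α (t x)` and `[t y, t z]`;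
  -- the relator then vanishes by the Hom-Leibniz identity in `F`.
  have hτB : L.boundaries 2 ≤ C.comap τ := L.boundaries_two_le fun x y z => by
    have h₁ : LF.bracket (t (L.α x)) (t (L.bracket y z)) -
        LF.bracket (LF.α (t x)) (LF.bracket (t y) (t z)) ∈ C :=
      bracket_sub_bracket_mem_commutator (by simp only [hπ.map_α, ht])
        (by simp only [hπ.map_bracket, ht])
    have h₂ : ∀ y z, LF.bracket (t (L.bracket x y)) (t (L.α z)) -
        LF.bracket (LF.bracket (t x) (t y)) (LF.α (t z)) ∈ C := fun y z =>
      bracket_sub_bracket_mem_commutator (by simp only [hπ.map_bracket, ht])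
        (by simp only [hπ.map_α, ht])
    have h := sub_mem h₁ (sub_mem (h₂ y z) (h₂ z y))
    rw [LF.hom_leibniz] at h
    simp only [Submodule.mem_comap, map_sub, hτ]
    convert h using 1
    abel
  have hsurj : LF.commutator ⊤ ⊤ ≤ LinearMap.range τ ⊔ C := by
    have h : ∀ x y, LF.bracket x y ∈ LinearMap.range τ ⊔ C := fun x y => by
      rw [← sub_add_cancel (LF.bracket x y) (LF.bracket (t (π x)) (t (π y))), add_comm, ← hτ]
      exact Submodule.add_mem_sup (LinearMap.mem_range_self _ _) (by
        rw [hτ]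
        exact bracket_sub_bracket_mem_commutator (ht _).symm (ht _).symm)
    -- Here the ideal is all of `F`, so `[F, F]` is the span of the products.
    exact LF.commutator_top_le (fun _ _ => Submodule.mem_top) (fun _ _ _ => Submodule.mem_top)
      (fun _ _ _ => Submodule.mem_top) fun x y _ => ⟨h x y, h y x⟩
  have hτN : ∀ z ∈ L.cycles 2, τ z ∈ N := fun z hz =>
    ⟨(hπτ z).trans (L.mem_cycles_two.1 hz), hτcomm z⟩
  let Φ : ↥(L.cycles 2) →ₗ[K] SchurMultiplier LF π := (C.comap N.subtype).mkQ ∘ₗ τ.restrict hτN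
  have hΦker : (L.boundaries 2).comap (L.cycles 2).subtype = LinearMap.ker Φ := by
    ext z
    have h : z ∈ LinearMap.ker Φ ↔ τ z ∈ C := Submodule.Quotient.mk_eq_zero _
    rw [h, Submodule.mem_comap]
    refine ⟨fun hz => hτB hz, fun hz => ?_⟩
    -- Injectivity: `τ z ∈ C` gives `σ (τ z) = 0`, and `σ (τ z)` is the class of `z`.
    have h' := hσC hz
    rw [LinearMap.mem_ker, hστ] at h'
    exact (Submodule.Quotient.mk_eq_zero _).1 h'
  have hΦsurj : Function.Surjective Φ := by
    intro c
    obtain ⟨c, rfl⟩ := Submodule.mkQ_surjective _ c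
    obtain ⟨_, ⟨w, rfl⟩, r, hr, hc⟩ := Submodule.mem_sup.1 (hsurj c.2.2)
    -- In `c = τ w + r` both `c` and `r ∈ C` lie in `ker π`, so the product of `w`, which is `π (τ
    -- w)`, vanishes.
    have hw : w ∈ L.cycles 2 := by
      have hcπ : π c = 0 := c.2.1
      have hrπ : π r = 0 := hπ.commutator_top_ker_le_ker hr
      rw [mem_cycles_two, ← hπτ]
      rwa [← hc, map_add, hrπ, add_zero] at hcπ
    refine ⟨⟨w, hw⟩, (Submodule.Quotient.eq _).2 ?_⟩
    change τ w - c ∈ C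
    rw [← hc, sub_add_cancel_left]
    exact neg_mem hr
  refine ⟨(Submodule.quotEquivOfEq _ _ hΦker).trans (Φ.quotKerEquivOfSurjective hΦsurj),
    fun z => ?_⟩
  obtain ⟨z, rfl⟩ := Submodule.mkQ_surjective _ z
  exact (Submodule.Quotient.eq _).2 (hτα z)
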